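/- An automatic algebra is an algebra $\mathbf M=\langle Q\cup\Sigma\cup\{0\};\cdot\rangle$ with one binary operation that encodes a partial automaton with state set $Q$ and alphabet $\Sigma$, where $Q$, $\Sigma$ and $\{0\}$ are pairwise disjoint: for $q,r\in Q$ and $a\in\Sigma$ we have $q\cdot a=r$ if and only if the automaton has an edge $q\overset{a}{\to} r$, and all other products equal $0$. Write $q\cdot a^k=(\cdots((q\cdot a)\cdot a)\cdots)\cdot a$ with $k$ occurrences of $a$. A letter $a\in\Sigma$ acts as whiskery cycles if for every $q\in Q$ there is an integer $n\ge 1$ with $q\cdot a=q\cdot a^{n+1}$. Let $\mathbf N$ be a finite algebra with underlying set $N$. An alter ego of $\mathbf N$ is a structure $\mathbb N$ on $N$, with the discrete topology, given by finitary operations, partial operations and relations that are compatible with $\mathbf N$ (relations and graphs of (partial) operations are subuniverses of finite powers of $\mathbf N$). The algebra $\mathbf N$ is dualizable if it has an alter ego $\mathbb N$ such that, for each $\mathbf A\in\mathbb{ISP}(\mathbf N)$, the evaluation map $a\mapsto(x\mapsto x(a))$ is an isomorphism from $\mathbf A$ onto the algebra of all continuous structure-preserving maps $\hom(\mathbf A,\mathbf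 N)\to\mathbb N$, where $\hom(\mathbf A,\mathbf N)$ has the topology and the structure inherited pointwise from the power $\mathbb N^{A}$. A finite algebra $\mathbf M$ is inherently non-dualizable if every finite algebra that has $\mathbf M$ as a subalgebra is non-dualizable. Theorem. Let $\mathbf M$ be a finite automatic algebra and let $a\in\Sigma$. If $a$ does not act as whiskery cycles, then $\mathbf M$ is inherently non-dualizable. -/

import Mathlib

/-- The carrier `Q ∪ S ∪ {0}` (a disjoint union) of the automatic algebra of a partial automaton
with state set `Q`, alphabet `S` and partial transition function `δ`. -/
inductive AutomaticAlgebra {Q : Type*} {S : Type*} (δ : Q → S → Option Q) where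
  | state (q : Q)
  | letter (a : S)
  | zero

namespace AutomaticAlgebra

variable {Q : Type*} {S : Type*} (δ : Q → S → Option Q)

/-- `q · a = r` if the automaton has an edge from `q` to `r` labelled `a`; every other product is
the default element `0`. -/
def mul : AutomaticAlgebra δ → AutomaticAlgebra δ → AutomaticAlgebra δ
  | state q, letter a =>
    match δ q a with
    | some r => state r
    | none => zero
  | _, _ => zero

instance : Mul (AutomaticAlgebra δ) := ⟨mul δ⟩

/-- `u · v ^ k`, bracketed from the left: `(⋯((u · v) · v)⋯) · v` with `k` occurrences of `v`. -/
def mulPow {M : Type*} [Mul M] (u v : M) (k : ℕ) : M := (fun x => x * v)^[k] u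

/-- The letter `a` acts as whiskery cycles: for every state `q` there is a positive integer `n`
with `q · a = q · a ^ (n + 1)`. -/
def ActsAsWhiskeryCycles (a : S) : Prop :=
  ∀ q : Q, ∃ n : ℕ, 1 ≤ n ∧
    (state q : AutomaticAlgebra δ) * letter a = mulPow (state q) (letter a) (n + 1)

end AutomaticAlgebra

namespace NaturalDuality

/-- `A` belongs to the quasi-variety `ISP(M)`: it is isomorphic to a (nonempty) subalgebra of a
power of `M`. -/
def MemISP.{w, v} (M : Type v) [Mul M] (A : Type w) [Mul A] : Prop :=
  Nonempty A ∧ ∃ (I : Type w) (f : A →ₙ* (I → M)), Function.Injective f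

/-- An alter ego of the groupoid `M`: a structure on the set `M` (which carries the discrete
topology) given by finitary total operations, partial operations and relations that are all
compatible with `M`. A relation is compatible if it is a subuniverse of `M ^ n`; a total operation
is compatible if it is a homomorphism `M ^ n → M`; a partial operation is compatible if its domain
is a subuniverse of `M ^ n` and it is a homomorphism on it. (`Subsemigroup` only asks for closure
under the multiplication; no associativity is involved.) -/
structure AlterEgo (M : Type*) [Mul M] where
  ops : (n : ℕ) → Set ((Fin n → M) →ₙ* M)
  partialOps : (n : ℕ) → Set (Σ D : Subsemigroup (Fin n → M), D →ₙ* M)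
  rels : (n : ℕ) → Set (Subsemigroup (Fin n → M))

/-- The topology of the dual `D(A) = hom(A, M)`: the subspace topology from the power `M ^ A` of
the discrete space `M`. -/
@[reducible] def dualTopology (A M : Type*) [Mul A] [Mul M] : TopologicalSpace (A →ₙ* M) :=
  TopologicalSpace.induced (fun x : A →ₙ* M => (x : A → M))
    (@Pi.topologicalSpace A (fun _ => M) (fun _ => ⊥))

/-- The homomorphism `a ↦ h(x₁(a), …, xₙ(a))`, where `h` is a compatible partial operation and
`(x₁, …, xₙ)` is in the domain of the pointwise extension of `h` to `hom(A, M)`. -/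
def pointwise {A M : Type*} [Mul A] [Mul M] {n : ℕ} {D : Subsemigroup (Fin n → M)}
    (h : D →ₙ* M) (x : Fin n → (A →ₙ* M)) (hx : ∀ a, (fun i => x i a) ∈ D) : A →ₙ* M where
  toFun a := h ⟨fun i => x i a, hx a⟩
  map_mul' a b := by
    rw [← map_mul h]
    congr 1
    apply Subtype.ext
    funext i
    exact map_mul (x i) a b

/-- `α` belongs to `ED(A)`: it is a continuous structure-preserving map from the dual
`D(A) = hom(A, M)`, with the structure of the alter ego `T` extended pointwise, to the alter ego. -/
structure AlterEgo.IsMorphism {M : Type*} [Mul M] (T : AlterEgo M) {A : Type*} [Mul A]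
    (α : (A →ₙ* M) → M) : Prop where
  continuous : @Continuous _ _ (dualTopology A M) ⊥ α
  map_op : ∀ (n : ℕ), ∀ g ∈ T.ops n, ∀ x : Fin n → (A →ₙ* M),
    α (g.comp (MulHom.pi x)) = g (fun i => α (x i))
  map_partialOp : ∀ (n : ℕ), ∀ h ∈ T.partialOps n, ∀ (x : Fin n → (A →ₙ* M))
    (hx : ∀ a, (fun i => x i a) ∈ h.1),
    ∃ hα : (fun i => α (x i)) ∈ h.1, α (pointwise h.2 x hx) = h.2 ⟨fun i => α (x i), hα⟩
  map_rel : ∀ (n : ℕ), ∀ r ∈ T.rels n, ∀ x : Fin n → (A →ₙ* M),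
    (∀ a, (fun i => x i a) ∈ r) → (fun i => α (x i)) ∈ r

/-- The (finite) groupoid `M` is dualizable: some alter ego yields a natural duality on `ISP(M)`,
that is, for every `A` in `ISP(M)` the natural evaluation map `a ↦ (x ↦ x(a))` is a bijection
(hence an isomorphism, the operation of `ED(A)` being pointwise) from `A` onto `ED(A)`. -/
def Dualizable.{w, v} (M : Type v) [Mul M] : Prop :=
  ∃ T : AlterEgo M, ∀ (A : Type w) [Mul A], MemISP M A →
    Set.BijOn (fun (a : A) (x : A →ₙ* M) => x a) Set.univ {α | T.IsMorphism α}

/-- The finite groupoid `M` is inherently non-dualizable: every finite groupoid that has `M` as a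
subalgebra (up to isomorphism) is non-dualizable. -/
def InherentlyNonDualizable.{w, v, u} (M : Type u) [Mul M] : Prop :=
  ∀ (N : Type v) [Mul N] [Finite N] (i : M →ₙ* N), Function.Injective i → ¬ Dualizable.{w} N

end NaturalDuality

universe w v u₁ u₂

/-! ### Ghost elements and popular values. -/

namespace NaturalDuality

/-! This is a ghost-element argument. Choose a state `q` whose value `q·a` never recurs further
along its `a`-orbit. In a power of the automatic algebra, elements `y i` converge pointwise to a
ghost with value `q·a` at one coordinate and `0` elsewhere. They lie in a subalgebra `witness` that
omits the ghost: a product of generators always leaves an extra nonzero coordinate, and multiplying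
a later orbit value by `a` cannot give `q·a` again. Each `y i` and `z j` is a product in a grid, so
pigeonhole (`exists_popular_value`) makes every homomorphism into a finite `N` constant on the `y i`
with boundedly many exceptions. Sending a homomorphism to this popular value is a morphism for every
alter ego, so duality would make it evaluation at some element (`Dualizable.exists_limit`). The
coordinate projections identify that element as the ghost. -/

open Classical in
/-- In a dualizable finite groupoid, a sequence along which every homomorphism is constant up to
a uniformly bounded number of exceptions has a limit in the algebra. -/
theorem Dualizable.exists_limit.{x₁, x₂} {N : Type x₂} [Mul N] (hN : Dualizable.{x₁} N)
    {A : Type x₁} [Mul A] (hA : MemISP N A) (y : ℕ → A) (K : ℕ)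
    (hy : ∀ x : A →ₙ* N, ∃ c, ∀ E : Finset ℕ, (∀ i ∈ E, x (y i) ≠ c) → E.card ≤ K) :
    ∃ b : A, ∀ (x : A →ₙ* N) (c : N), {i | x (y i) ≠ c}.Finite → x b = c := by
  obtain ⟨T, hT⟩ := hN
  choose α hα using hy
  have hfin : ∀ x : A →ₙ* N, {i | x (y i) ≠ α x}.Finite := by
    intro x
    by_contra hinf
    obtain ⟨E, hE, hcard⟩ := Set.Infinite.exists_subset_card_eq hinf (K + 1)
    have := hα x E (fun i hi => hE hi)
    omega
  -- On finitely many homomorphisms `α` is evaluation at a single `y i`, and evaluations preserve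
  -- every compatible structure.
  have hlocal : ∀ (n : ℕ) (x : Fin n → (A →ₙ* N)) (x' : A →ₙ* N),
      ∃ i, (∀ k, x k (y i) = α (x k)) ∧ x' (y i) = α x' := by
    intro n x x'
    have h1 : ((⋃ k, {i | x k (y i) ≠ α (x k)}) ∪ {i | x' (y i) ≠ α x'}).Finite :=
      (Set.finite_iUnion fun k => hfin (x k)).union (hfin x')
    obtain ⟨i, hi⟩ := h1.exists_notMem
    refine ⟨i, fun k => ?_, ?_⟩
    · by_contra h
      exact hi (Or.inl (Set.mem_iUnion.2 ⟨k, h⟩))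
    · by_contra h
      exact hi (Or.inr h)
  have hcont : @Continuous _ _ (dualTopology A N) ⊥ α := by
    let _ : TopologicalSpace N := ⊥
    have : DiscreteTopology N := ⟨rfl⟩
    let _ : TopologicalSpace (A →ₙ* N) := dualTopology A N
    -- Two homomorphisms have at most `2 * K` exceptions together, so one of `2 * K + 1` indices is
    -- good for both. Hence these values determine `α`.
    let ev : (A →ₙ* N) → Fin (2 * K + 1) → N := fun x i => x (y i)
    have hev : Continuous ev :=
      continuous_pi fun i => (continuous_apply (y i)).comp continuous_induced_dom
    have hfac : Function.FactorsThrough α ev := by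
      intro x x' h
      by_contra hne
      have h1 := hα x ((Finset.range (2 * K + 1)).filter fun i => x (y i) ≠ α x) (by simp)
      have h2 := hα x' ((Finset.range (2 * K + 1)).filter fun i => x' (y i) ≠ α x') (by simp)
      have h3 : Finset.range (2 * K + 1) ⊆
          ((Finset.range (2 * K + 1)).filter fun i => x (y i) ≠ α x) ∪
          ((Finset.range (2 * K + 1)).filter fun i => x' (y i) ≠ α x') := by
        intro i hi
        have h4 : x (y i) = x' (y i) := congrFun h ⟨i, Finset.mem_range.1 hi⟩
        simp only [Finset.mem_union, Finset.mem_filter]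
        by_cases h5 : x (y i) = α x
        · exact Or.inr ⟨hi, fun h6 => hne (by rw [← h5, h4, h6])⟩
        · exact Or.inl ⟨hi, h5⟩
      have h4 := (Finset.card_le_card h3).trans (Finset.card_union_le _ _)
      rw [Finset.card_range] at h4
      omega
    obtain ⟨β, hβ⟩ : ∃ β : (Fin (2 * K + 1) → N) → N, β ∘ ev = α :=
      ⟨Function.extend ev α fun v => v 0, hfac.extend_comp _⟩
    rw [← hβ]
    exact continuous_of_discreteTopology.comp hev
  have hmor : T.IsMorphism α := by
    refine ⟨hcont, ?_, ?_, ?_⟩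
    · intro n g _ x
      obtain ⟨i, hi, hi'⟩ := hlocal n x (g.comp (MulHom.pi x))
      rw [← hi', ← funext hi]
      rfl
    · intro n h _ x hx
      obtain ⟨i, hi, hi'⟩ := hlocal n x (pointwise h.2 x hx)
      have hαi := funext hi
      refine ⟨hαi ▸ hx (y i), ?_⟩
      rw [← hi']
      change h.2 _ = h.2 _
      congr 1
      exact Subtype.ext hαi
    · intro n r _ x hx
      -- A nullary relation supplies no homomorphism to feed to `hlocal`.
      rcases Nat.eq_zero_or_pos n with rfl | hn
      · convert hx (y 0) using 1
      · obtain ⟨i, hi, -⟩ := hlocal n x (x ⟨0, hn⟩)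
        exact funext hi ▸ hx (y i)
  obtain ⟨b, -, hb⟩ := (hT A hA).surjOn hmor
  refine ⟨b, fun x c hc => ?_⟩
  obtain ⟨i, hi⟩ := ((hfin x).union hc).exists_notMem
  simp only [Set.mem_union, Set.mem_ofPred_eq, not_or, not_not] at hi
  exact (congrFun hb x).trans (hi.1.symm.trans hi.2)

/-- Membership in `ISP` of an algebra of functions into a subalgebra, made small. -/
theorem memISP_shrink.{x₁, x₂, x₃} {M : Type x₃} [Mul M] {N : Type x₂} [Mul N] (e : M →ₙ* N)
    (he : Function.Injective e) {I : Type} (A : Subsemigroup (I → M)) [Small.{x₁} A]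
    (hA : Nonempty A) : MemISP N (Shrink.{x₁} A) := by
  refine ⟨hA.map (equivShrink A), ULift.{x₁} I,
    ⟨fun u i => e (((equivShrink A).symm u).1 i.down), fun u u' => ?_⟩, fun u u' h => ?_⟩
  · funext i
    simp [equivShrink_symm_mul]
  · apply (equivShrink A).symm.injective
    apply Subtype.ext
    funext i
    exact he (congrFun h (ULift.up i))

/-- A homomorphism into a finite groupoid is constant along `y`, up to boundedly many exceptions,
when the `y i` and `z j` arise as products in a grid. -/
theorem exists_popular_value.{x₁, x₂} {A : Type x₁} [Mul A] {N : Type x₂} [Mul N] [Finite N]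
    (s a : ℕ → ℕ → A) (y z : ℕ → A)
    (hy : ∀ i j k, k ≠ i → s i j * a k j = y i) (hz : ∀ i j l, l ≠ j → s i j * a i l = z j)
    (x : A →ₙ* N) :
    ∃ c, ∀ E : Finset ℕ, (∀ i ∈ E, x (y i) ≠ c) → E.card ≤ Nat.card N * Nat.card N := by
  classical
  have := Fintype.ofFinite N
  rw [Nat.card_eq_fintype_card]
  have hblock : ∀ (I₁ I₂ : Finset ℕ) (c d : N), Fintype.card N < I₁.card →
      Fintype.card N < I₂.card → (∀ i ∈ I₁, x (y i) = c) → (∀ i ∈ I₂, x (y i) = d) → c = d := by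
    intro I₁ I₂ c d h₁ h₂ hc hd
    -- Infinitely many columns have only finitely many patterns on the two blocks. The same `j`
    -- serves both, so both values equal `x (z j)`.
    obtain ⟨j, l, hjl, hrow⟩ := Finite.exists_ne_map_eq_of_infinite
      (fun (j : ℕ) (i : (I₁ ∪ I₂ : Finset ℕ)) => x (a i j))
    have key : ∀ (I : Finset ℕ), I ⊆ I₁ ∪ I₂ → ∀ c, Fintype.card N < I.card →
        (∀ i ∈ I, x (y i) = c) → c = x (z j) := by
      intro I hI c hcard hc
      obtain ⟨i, hi, k, hk, hik, hcol⟩ := Finset.exists_ne_map_eq_of_card_lt_of_maps_to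
        (t := (Finset.univ : Finset N)) (f := fun i => x (a i j)) (by simpa using hcard)
        (fun i _ => by simp)
      have hrow' : x (a i j) = x (a i l) := congrFun hrow ⟨i, hI hi⟩
      have hcol' : x (a i j) = x (a k j) := hcol
      -- The forbidden product `s i j * a i j` links the two: its image under `x` equals both `x (y
      -- i)` and `x (z j)`.
      rw [← hc i hi, ← hy i j k hik.symm, ← hz i j l hjl.symm, map_mul, map_mul, ← hcol', hrow']
    rw [key I₁ Finset.subset_union_left c h₁ hc, key I₂ Finset.subset_union_right d h₂ hd]
  obtain ⟨c, hc⟩ := Finite.exists_infinite_fiber (fun i => x (y i))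
  refine ⟨c, fun E hE => ?_⟩
  by_contra! hlt
  -- More than `|N| * |N|` exceptions would make some other value occur more than `|N|` times.
  obtain ⟨d, -, hd⟩ := Finset.exists_lt_card_fiber_of_mul_lt_card_of_maps_to
    (s := E) (t := (Finset.univ : Finset N)) (f := fun i => x (y i)) (fun i _ => by simp)
    (by simpa using hlt)
  obtain ⟨F, hF, hFc⟩ := (Set.infinite_coe_iff.1 hc).exists_subset_card_eq (Fintype.card N + 1)
  have hdc := hblock _ F d c hd (by omega) (fun i hi => (Finset.mem_filter.1 hi).2)
    (fun i hi => hF hi)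
  obtain ⟨i, hi⟩ := Finset.card_pos.1 (Nat.zero_lt_of_lt hd)
  rw [Finset.mem_filter] at hi
  exact hE i hi.1 (hi.2.trans hdc)

end NaturalDuality

namespace AutomaticAlgebra

section Multiplication

variable {Q : Type*} {S : Type*} {δ : Q → S → Option Q}

theorem mul_zero' (u : AutomaticAlgebra δ) : u * zero = zero := by
  cases u <;> rfl

theorem zero_mul' (u : AutomaticAlgebra δ) : zero * u = zero := by
  cases u <;> rfl

theorem mul_state (u : AutomaticAlgebra δ) (q : Q) : u * state q = zero := by
  cases u <;> rfl

theorem letter_mul (a : S) (u : AutomaticAlgebra δ) : letter a * u = zero := by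
  cases u <;> rfl

theorem mul_ne_letter (u v : AutomaticAlgebra δ) (a : S) : u * v ≠ letter a := by
  change mul δ u v ≠ letter a
  unfold mul
  split
  · split <;> simp
  · simp

theorem eq_letter_of_mul_ne_zero {u v : AutomaticAlgebra δ} (h : u * v ≠ zero) :
    ∃ b, v = letter b := by
  cases v with
  | state q => exact absurd (mul_state u q) h
  | letter b => exact ⟨b, rfl⟩
  | zero => exact absurd (mul_zero' u) h

end Multiplication

/-! ### The witnessing algebra and its missing ghost. -/

/-- Coordinates of the power that contains the witnessing algebra. -/
inductive WitnessIndex where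
  | base
  | row (i : ℕ)
  | col (j : ℕ)
  | cell (i j : ℕ)

open WitnessIndex

section Witness

variable {Q : Type*} {S : Type*} (δ : Q → S → Option Q) (q : Q) (a : S)

/-- The grid of state-valued generators. -/
def stateGen (i j : ℕ) : WitnessIndex → AutomaticAlgebra δ
  | base => state q
  | row i' => if i' = i then state q else zero
  | col j' => if j' = j then state q else zero
  | cell i' j' => if i' = i ∧ j' = j then state q else zero

/-- The grid of letter-valued generators. -/
def letterGen (k l : ℕ) : WitnessIndex → AutomaticAlgebra δ
  | base => letter a
  | row i => if i = k then zero else letter a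
  | col j => if j = l then zero else letter a
  | cell i j => if i = k ∧ j = l then letter a else zero

/-- The element with value `q · a` at `base` and `row i`. -/
def rowElem (i : ℕ) : WitnessIndex → AutomaticAlgebra δ
  | base => state q * letter a
  | row i' => if i' = i then state q * letter a else zero
  | _ => zero

/-- The element with value `q · a` at `base` and `col j`. -/
def colElem (j : ℕ) : WitnessIndex → AutomaticAlgebra δ
  | base => state q * letter a
  | col j' => if j' = j then state q * letter a else zero
  | _ => zero

/-- The element with value `q · a` only at `base`, which is missing from the witnessing algebra. -/
def ghost : WitnessIndex → AutomaticAlgebra δ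
  | base => state q * letter a
  | _ => zero

theorem stateGen_mul_letterGen_row (i j k : ℕ) (h : k ≠ i) :
    stateGen δ q i j * letterGen δ a k j = rowElem δ q a i := by
  funext c
  cases c <;> simp only [Pi.mul_apply, stateGen, letterGen, rowElem] <;> split_ifs <;>
    first
    | rfl
    | exact zero_mul' _
    | exact mul_zero' _
    | omega

theorem stateGen_mul_letterGen_col (i j l : ℕ) (h : l ≠ j) :
    stateGen δ q i j * letterGen δ a i l = colElem δ q a j := by
  funext c
  cases c <;> simp only [Pi.mul_apply, stateGen, letterGen, colElem] <;> split_ifs <;>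
    first
    | rfl
    | exact zero_mul' _
    | exact mul_zero' _
    | omega

/-- The `cell` coordinates serve the case of equal indices, where the product vanishes on all rows
and columns and would otherwise be the ghost. -/
theorem stateGen_mul_letterGen_ne_ghost (hr : (state q : AutomaticAlgebra δ) * letter a ≠ zero)
    (i j k l : ℕ) : stateGen δ q i j * letterGen δ a k l ≠ ghost δ q a := by
  intro h
  by_cases hik : i = k
  · by_cases hjl : j = l
    · exact hr (by simpa [stateGen, letterGen, ghost, hik, hjl] using congrFun h (cell i j))
    · exact hr (by simpa [stateGen, letterGen, ghost, hjl] using congrFun h (col j))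
  · exact hr (by simpa [stateGen, letterGen, ghost, hik] using congrFun h (row i))

variable {δ q a}

theorem mulPow_succ {M : Type*} [Mul M] (u v : M) (n : ℕ) :
    mulPow u v (n + 1) = mulPow u v n * v :=
  Function.iterate_succ_apply' _ _ _

theorem state_mul_letter_ne_zero (hq : ∀ n : ℕ, 1 ≤ n →
    (state q : AutomaticAlgebra δ) * letter a ≠ mulPow (state q) (letter a) (n + 1)) :
    (state q : AutomaticAlgebra δ) * letter a ≠ zero := by
  intro h
  apply hq 1 le_rfl
  change _ = state q * letter a * letter a
  rw [h, zero_mul']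

/-- The values at `base` of the elements of the witnessing algebra that are not generators. -/
def IsOrbitValue (u : AutomaticAlgebra δ) (q : Q) (a : S) : Prop :=
  u = zero ∨ ∃ n : ℕ, 1 ≤ n ∧ u = mulPow (state q) (letter a) n

theorem IsOrbitValue.ne_letter {u : AutomaticAlgebra δ} (h : IsOrbitValue u q a) (b : S) :
    u ≠ letter b := by
  rcases h with rfl | ⟨n, hn, rfl⟩
  · exact fun h => nomatch h
  · obtain ⟨m, rfl⟩ := Nat.exists_eq_add_of_le' hn
    rw [mulPow_succ]
    exact mul_ne_letter _ _ _

theorem IsOrbitValue.mul_letter {u : AutomaticAlgebra δ} (h : IsOrbitValue u q a) :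
    IsOrbitValue (u * letter a) q a := by
  rcases h with rfl | ⟨n, hn, rfl⟩
  · exact Or.inl (zero_mul' _)
  · exact Or.inr ⟨n + 1, by omega, (mulPow_succ _ _ _).symm⟩

/-- The witnessing algebra: it contains both grids of generators but not the ghost element. -/
def witness (hq : ∀ n : ℕ, 1 ≤ n →
    (state q : AutomaticAlgebra δ) * letter a ≠ mulPow (state q) (letter a) (n + 1)) :
    Subsemigroup (WitnessIndex → AutomaticAlgebra δ) where
  carrier := {f | (∃ i j, f = stateGen δ q i j) ∨ (∃ k l, f = letterGen δ a k l) ∨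
    (IsOrbitValue (f base) q a ∧ f ≠ ghost δ q a)}
  mul_mem' := by
    intro f g hf hg
    refine Or.inr (Or.inr ?_)
    have hr := state_mul_letter_ne_zero hq
    by_cases hz : (f * g) base = zero
    · exact ⟨Or.inl hz, fun h => hr ((congrFun h base).symm.trans hz)⟩
    obtain ⟨b, hb⟩ := eq_letter_of_mul_ne_zero (u := f base) (v := g base) hz
    obtain ⟨k, l, rfl⟩ : ∃ k l, g = letterGen δ a k l := by
      rcases hg with ⟨i, j, rfl⟩ | hg | hg
      · exact nomatch hb
      · exact hg
      · exact absurd hb (hg.1.ne_letter b)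
    rcases hf with ⟨i, j, rfl⟩ | ⟨k', l', rfl⟩ | hf
    · exact ⟨Or.inr ⟨1, le_rfl, rfl⟩, stateGen_mul_letterGen_ne_ghost δ q a hr i j k l⟩
    · exact absurd (letter_mul _ _) hz
    -- Here the hypothesis on `q` enters: the base value is `0` or `q·a^(n+1)` with `n ≥ 1`, never
    -- `q·a`.
    · refine ⟨hf.1.mul_letter, fun h => ?_⟩
      have hbase : f base * letter a = state q * letter a := congrFun h base
      rcases hf.1 with h0 | ⟨n, hn, h0⟩
      · rw [h0, zero_mul'] at hbase
        exact hr hbase.symm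
      · rw [h0, ← mulPow_succ] at hbase
        exact hq n hn hbase.symm

theorem ghost_notMem_witness (hq : ∀ n : ℕ, 1 ≤ n →
    (state q : AutomaticAlgebra δ) * letter a ≠ mulPow (state q) (letter a) (n + 1)) :
    ghost δ q a ∉ witness hq := by
  rintro (⟨i, j, h⟩ | ⟨k, l, h⟩ | h)
  · have hbase : state q * letter a = state q := congrFun h base
    apply hq 1 le_rfl
    change _ = state q * letter a * letter a
    rw [hbase, hbase]
  · exact mul_ne_letter _ _ _ (congrFun h base)
  · exact h.2 rfl

end Witness

end AutomaticAlgebra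

open AutomaticAlgebra AutomaticAlgebra.WitnessIndex NaturalDuality in
/-- If some state has no return after its first step along `a`, no finite extension is
dualizable. -/
theorem AutomaticAlgebra.inherentlyNonDualizable_of_no_return.{x₁, x₂, x₃, x₄}
    {Q : Type x₃} {S : Type x₄} {δ : Q → S → Option Q} {q : Q} {a : S}
    (hq : ∀ n : ℕ, 1 ≤ n →
      (state q : AutomaticAlgebra δ) * letter a ≠ mulPow (state q) (letter a) (n + 1)) :
    InherentlyNonDualizable.{x₁, x₂, max x₃ x₄} (AutomaticAlgebra δ) := by
  intro N _ _ e he hdual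
  have : Finite (AutomaticAlgebra δ) := Finite.of_injective e he
  let W := witness hq
  have : Small.{x₁} WitnessIndex :=
    small_of_injective (f := fun c : WitnessIndex => (match c with
      | base => Sum.inl none
      | row i => Sum.inl (some (Sum.inl i))
      | col j => Sum.inl (some (Sum.inr j))
      | cell i j => Sum.inr (i, j) : Option (ℕ ⊕ ℕ) ⊕ ℕ × ℕ)) (by
        rintro (_ | _ | _ | _) (_ | _ | _ | _) h <;> simp_all)
  have : Small.{x₁} W := small_of_injective.{x₁} (f := fun f : W => f.1) Subtype.val_injective
  let s : ℕ → ℕ → W := fun i j => ⟨stateGen δ q i j, Or.inl ⟨i, j, rfl⟩⟩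
  let b : ℕ → ℕ → W := fun k l => ⟨letterGen δ a k l, Or.inr (Or.inl ⟨k, l, rfl⟩)⟩
  let y : ℕ → W := fun i => s i 0 * b (i + 1) 0
  let z : ℕ → W := fun j => s 0 j * b 0 (j + 1)
  have hyrow : ∀ i, (y i).1 = rowElem δ q a i := fun i =>
    stateGen_mul_letterGen_row δ q a i 0 (i + 1) (by omega)
  have hzcol : ∀ j, (z j).1 = colElem δ q a j := fun j =>
    stateGen_mul_letterGen_col δ q a 0 j (j + 1) (by omega)
  let φ := (Shrink.mulEquiv (α := W)).symm
  obtain ⟨g, hg⟩ := hdual.exists_limit (memISP_shrink e he W ⟨s 0 0⟩) (fun i => φ (y i))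
    (Nat.card N * Nat.card N) (fun x =>
      exists_popular_value (fun i j => φ (s i j)) (fun k l => φ (b k l)) _ (fun j => φ (z j))
        (fun i j k h => by
          rw [← map_mul]
          exact congrArg φ (Subtype.ext
            ((stateGen_mul_letterGen_row δ q a i j k h).trans (hyrow i).symm)))
        (fun i j l h => by
          rw [← map_mul]
          exact congrArg φ (Subtype.ext
            ((stateGen_mul_letterGen_col δ q a i j l h).trans (hzcol j).symm)))
        x)
  have hcoord : ∀ c, (φ.symm g).1 c = ghost δ q a c := by
    intro c
    let x : Shrink.{x₁} W →ₙ* N :=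
      ⟨fun u => e ((φ.symm u).1 c), fun u u' => by rw [map_mul, ← map_mul e]; rfl⟩
    refine he (hg x (e (ghost δ q a c)) ?_)
    -- At a fixed coordinate at most one `y i` differs from the ghost.
    have hsub : {i | x (φ (y i)) ≠ e (ghost δ q a c)} ⊆ {i | c = row i} := by
      intro i hi
      by_contra hne
      apply hi
      change e ((φ.symm (φ (y i))).1 c) = _
      rw [MulEquiv.symm_apply_apply, hyrow]
      cases c with
      | row i' =>
        have : i' ≠ i := fun h => hne (congrArg row h)
        simp [rowElem, ghost, this]
      | _ => rfl
    refine Set.Finite.subset (Set.Subsingleton.finite ?_) hsub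
    intro i hi j hj
    exact row.inj (hi.symm.trans hj)
  exact ghost_notMem_witness hq (funext hcoord ▸ (φ.symm g).2)

theorem theorem2p4 {Q : Type u₁} {S : Type u₂} [Finite Q] [Finite S]
    (δ : Q → S → Option Q) (a : S)
    (ha : ¬ AutomaticAlgebra.ActsAsWhiskeryCycles δ a) :
    NaturalDuality.InherentlyNonDualizable.{w, v, max u₁ u₂} (AutomaticAlgebra δ) := by
  simp only [AutomaticAlgebra.ActsAsWhiskeryCycles, not_forall, not_exists, not_and] at ha
  obtain ⟨q, hq⟩ := ha
  exact AutomaticAlgebra.inherentlyNonDualizable_of_no_return hq
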